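/- Let $\Omega$ be a nonempty set, let $\mathbb K$ be a nonempty set of maps $z:[0,\infty)\to\Omega$, and let $g:\Omega\to[0,1]$ be such that $t\mapsto g(z(t))$ is Lebesgue measurable for every $z\in\mathbb K$. Let $\mathfrak C$ and $\mathfrak U$ be the sets of all bounded functions $\mathbb K\to\mathbb R$ and $\Omega\to\mathbb R$, respectively. A map $\mathbb V:\mathfrak C\to\mathfrak U$ is called a game map if $\mathbb V[Ac+B]=A\,\mathbb V[c]+B$ for all $c\in\mathfrak C$, $A\ge 0$, $B\in\mathbb R$, and if $c_1\le c_2$ on $\mathbb K$ implies $\mathbb V[c_1]\le\mathbb V[c_2]$ on $\Omega$. Let $\mathfrak D$ be the set of all probability densities $\varrho:[0,\infty)\to[0,\infty)$, that is, Lebesgue measurable functions with $\int_0^\infty\varrho(t)\,dt=1$. For $\varrho\in\mathfrak D$ and $\lambda,T>0$ put $\varrho^\lambda_{\rm scale}(t)=\lambda\varrho(\lambda t)$ and, if $\int_T^\infty\varrho(s)\,ds>0$, $\varrho^T_{\rm shift}(t)=\varrho(t+T)\big/\int_T^\infty\varrho(s)\,ds$. Put $\mathfrak c[\varrho](z)=\int_0^\infty\varrho(t)g(z(t))\,dt$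 for $z\in\mathbb K$, and $\mathcal V[\varrho]=\mathbb V[\mathfrak c[\varrho]]$. Let $\varpi_T=\frac1T 1_{[0,T]}$ and $\pi_\lambda(t)=\lambda e^{-\lambda t}$. A density $\varrho\in\mathfrak D$ is called a power density if there are $\alpha,\beta,\gamma>0$ with $\varrho(t)=(\alpha+\beta t)^{-\gamma}$ for all $t\ge0$. A function is piecewise continuous on $(0,\infty)$ if it has only finitely many discontinuities in each compact subinterval of $(0,\infty)$ and has finite one-sided limits at every point of $(0,\infty)$. Assume that $\mathbb V$ is a game map that satisfies the dynamic programming principle on $\mathfrak D$: for all $\varrho\in\mathfrak D$ and $T>0$ with $\int_T^\infty\varrho(s)\,ds>0$, the payoff $$z\mapsto\int_0^T\varrho(t)g(z(t))\,dt+\int_T^\infty\varrho(s)\,ds\cdot\mathcal V[\varrho^T_{\rm shift}](z(T))$$ has the same image under $\mathbb V$ as the payoff $\mathfrak c[\varrho]$. Then for every function $U_*:\Omega\to[0,1]$ the following conditions are equivalent: (c) for every density $\mu\in\mathfrak D$ that is piecewise continuous on $(0,\infty)$, $\mathcal V[\mu^\lambda_{\rm scale}]\to U_*$ uniformly on $\Omega$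 as $\lambda\to+0$; (u) $\mathcal V[\varpi_T]\to U_*$ uniformly on $\Omega$ as $T\to+\infty$; (e) $\mathcal V[\pi_\lambda]\to U_*$ uniformly on $\Omega$ as $\lambda\to+0$; (p) for some power density $\varrho\in\mathfrak D$, $\mathcal V[\varrho^T_{\rm shift}]\to U_*$ uniformly on $\Omega$ as $T\to+\infty$; (q) for every power density $\varrho\in\mathfrak D$, $\mathcal V[\varrho^T_{\rm shift}]\to U_*$ uniformly on $\Omega$ as $T\to+\infty$. In particular, if at least one of the limits $\lim_{T\to+\infty}\mathcal V[\varpi_T]$, $\lim_{\lambda\to+0}\mathcal V[\pi_\lambda]$, or $\lim_{T\to+\infty}\mathcal V[\varrho^T_{\rm shift}]$ for some power density $\varrho$, exists uniformly on $\Omega$, then these limits, for all power densities $\varrho$, and the limits $\lim_{\lambda\to+0}\mathcal V[\mu^\lambda_{\rm scale}]$, for all densities $\mu\in\mathfrak D$ piecewise continuous on $(0,\infty)$, all exist, are uniform on $\Omega$, and coincide. -/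

import Mathlib

open MeasureTheory Set Filter Topology
open scoped NNReal

namespace GameMap

/-- A bounded real function (a payoff on the set of processes, or a value function on the set of
states). -/
def IsBdd {X : Type*} (f : X → ℝ) : Prop :=
  ∃ M : ℝ, ∀ x, |f x| ≤ M

/-- `V` is a game map from payoffs on the set of processes `K` to functions on the set of states
`Ω`: it sends bounded functions to bounded functions, is positively affine and is monotone.
`V` is only meaningful on bounded payoffs; nothing is required of its values elsewhere. -/
structure IsGameMap {Ω : Type*} {K : Set (ℝ≥0 → Ω)} (V : (K → ℝ) → Ω → ℝ) : Prop where
  bounded : ∀ c : K → ℝ, IsBdd c → IsBdd (V c)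
  affine : ∀ c : K → ℝ, IsBdd c → ∀ A B : ℝ, 0 ≤ A → ∀ ω,
    V (fun z => A * c z + B) ω = A * V c ω + B
  mono : ∀ c₁ c₂ : K → ℝ, IsBdd c₁ → IsBdd c₂ → (∀ z, c₁ z ≤ c₂ z) → ∀ ω, V c₁ ω ≤ V c₂ ω

/-- `ρ` is a probability density on `[0, ∞)`. Its values at negative arguments are irrelevant. -/
structure IsDensity (ρ : ℝ → ℝ) : Prop where
  nonneg : ∀ t, 0 ≤ t → 0 ≤ ρ t
  integrable : IntegrableOn ρ (Ioi 0)
  integral_eq_one : ∫ t in Ioi 0, ρ t = 1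

/-- The mass `∫_T^∞ ρ(t) dt`. -/
noncomputable def tail (ρ : ℝ → ℝ) (T : ℝ) : ℝ :=
  ∫ t in Ioi T, ρ t

/-- The density `t ↦ ρ(t + T) / ∫_T^∞ ρ`, used when `∫_T^∞ ρ > 0`. -/
noncomputable def shift (ρ : ℝ → ℝ) (T : ℝ) : ℝ → ℝ :=
  fun t => ρ (t + T) / tail ρ T

/-- The density `t ↦ l ρ(l t)`, used for `l > 0`. -/
def scale (ρ : ℝ → ℝ) (l : ℝ) : ℝ → ℝ :=
  fun t => l * ρ (l * t)

/-- The density of the uniform distribution on `[0, T]`. -/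
noncomputable def uniformDensity (T : ℝ) : ℝ → ℝ :=
  (Icc 0 T).indicator (fun _ => 1 / T)

/-- The density of the exponential distribution with rate `l`. -/
noncomputable def expDensity (l : ℝ) : ℝ → ℝ :=
  fun t => l * Real.exp (-l * t)

/-- A power density: a density of the form `(α + β t) ^ (-γ)` with `α, β, γ > 0`. -/
def IsPowerDensity (ρ : ℝ → ℝ) : Prop :=
  IsDensity ρ ∧ ∃ α β γ : ℝ, 0 < α ∧ 0 < β ∧ 0 < γ ∧ ∀ t, 0 ≤ t → ρ t = 1 / (α + β * t) ^ γ

/-- Piecewise continuity on `(0, ∞)`: every compact subinterval of `(0, ∞)` contains only finitely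
many points of discontinuity, and both one-sided limits exist at every point of `(0, ∞)`. -/
def IsPiecewiseContinuous (f : ℝ → ℝ) : Prop :=
  (∀ a b : ℝ, 0 < a → {t ∈ Icc a b | ¬ ContinuousAt f t}.Finite) ∧
  ∀ t : ℝ, 0 < t → (∃ l, Tendsto f (𝓝[<] t) (𝓝 l)) ∧ (∃ r, Tendsto f (𝓝[>] t) (𝓝 r))

section
variable {Ω : Type*} {K : Set (ℝ≥0 → Ω)}

/-- The payoff `z ↦ ∫_0^∞ ρ(t) g(z(t)) dt`. -/
noncomputable def payoff (g : Ω → ℝ) (ρ : ℝ → ℝ) (z : K) : ℝ :=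
  ∫ t in Ioi (0 : ℝ), ρ t * g (z.1 t.toNNReal)

/-- The value function `V[payoff of ρ]`. -/
noncomputable def value (V : (K → ℝ) → Ω → ℝ) (g : Ω → ℝ) (ρ : ℝ → ℝ) : Ω → ℝ :=
  V (payoff g ρ)

/-- The payoff `z ↦ ∫_0^T ρ(t) g(z(t)) dt + (∫_T^∞ ρ) · value[shift of ρ by T](z(T))`. -/
noncomputable def dynPayoff (V : (K → ℝ) → Ω → ℝ) (g : Ω → ℝ) (ρ : ℝ → ℝ) (T : ℝ) (z : K) : ℝ :=
  (∫ t in Ioc 0 T, ρ t * g (z.1 t.toNNReal)) + tail ρ T * value V g (shift ρ T) (z.1 T.toNNReal)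

/-- The dynamic programming principle on the set of all densities. -/
def DynProgPrinciple (V : (K → ℝ) → Ω → ℝ) (g : Ω → ℝ) : Prop :=
  ∀ ρ : ℝ → ℝ, IsDensity ρ → ∀ T : ℝ, 0 < T → 0 < tail ρ T →
    V (dynPayoff V g ρ T) = V (payoff g ρ)

/-- `value[scale of μ by l] → U` uniformly on `Ω` as `l → 0+`. -/
def ScaleLimit (V : (K → ℝ) → Ω → ℝ) (g : Ω → ℝ) (μ : ℝ → ℝ) (U : Ω → ℝ) : Prop :=
  TendstoUniformly (fun l : ℝ => value V g (scale μ l)) U (𝓝[>] 0)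

/-- `value[shift of ρ by T] → U` uniformly on `Ω` as `T → +∞`. -/
def ShiftLimit (V : (K → ℝ) → Ω → ℝ) (g : Ω → ℝ) (ρ : ℝ → ℝ) (U : Ω → ℝ) : Prop :=
  TendstoUniformly (fun T : ℝ => value V g (shift ρ T)) U atTop

/-- `value[uniform density on [0, T]] → U` uniformly on `Ω` as `T → +∞`. -/
def CesaroLimit (V : (K → ℝ) → Ω → ℝ) (g : Ω → ℝ) (U : Ω → ℝ) : Prop :=
  TendstoUniformly (fun T : ℝ => value V g (uniformDensity T)) U atTop

/-- `value[exponential density of rate l] → U` uniformly on `Ω` as `l → 0+`. -/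
def AbelLimit (V : (K → ℝ) → Ω → ℝ) (g : Ω → ℝ) (U : Ω → ℝ) : Prop :=
  TendstoUniformly (fun l : ℝ => value V g (expDensity l)) U (𝓝[>] 0)

end

end GameMap

/-!
A game map is monotone and commutes with the addition of constants, so it is nonexpansive for the
supremum norm; hence the value of a density depends on the density in a 1-Lipschitz way with respect
to the `L¹` norm.

The argument passes through a property of the state function `U` alone. Call `U` nearly invariant
(`GameMap.IsNearlyInvariant`) if, for small `p` and all large `T` (depending on `p`), the payoff that
averages `g` over `[0, T]` with total weight `p` and then collects `(1 - p) U(z(T))` has an image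
under `V` that differs from `U` by at most `ε p`.

The uniform and exponential densities and the power densities are self-similar: each shift of such a
density, by a time that leaves some mass, is again one of its scalings. If the values of the
scalings of such a density `ν` converge to `U`, the dynamic programming principle,
applied at the time before which the mass `p` is spent, expresses a value close to `U` through a
running payoff and a continuation value close to `U`. Since
`ν` is continuous and positive at `0`, it is nearly constant up to that time, with an `L¹` error
`o(p)`; so `U` is nearly invariant (`GameMap.IsSelfSimilar.isNearlyInvariant`).

Conversely, let `U` be nearly invariant and `μ` a continuous positive density. Cut `μ` off at a time
`L` after which little mass remains, and apply the dynamic programming principle backwards along a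
fine grid of `[0, L]`. Each step costs `ε` times its mass plus the oscillation of `μ`, and these
errors sum up to something small (`GameMap.hasLimitError_shift_grid`). The grid is fixed before the
scale tends to `0`, which is why near invariance need not be uniform in `p`. Approximation in `L¹`
then gives the scaling limit for every density (`GameMap.IsNearlyInvariant.scaleLimit`).

For a power density the shifts are precisely a reparametrization of the scalings with small
parameter, so limits of shifts are limits of scalings
(`GameMap.IsPowerDensity.shiftLimit_iff_scaleLimit`).
-/

namespace GameMap

/-! ### Densities, tails, shifts and scalings -/

theorem integral_Ioi_comp_add (f : ℝ → ℝ) (a T : ℝ) :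
    ∫ t in Ioi a, f (t + T) = ∫ t in Ioi (a + T), f t := by
  have h := (measurePreserving_add_right (volume : Measure ℝ) T).setIntegral_preimage_emb
    (measurableEmbedding_addRight T) f (Ioi (a + T))
  simpa using h

theorem integrableOn_Ioi_comp_add {f : ℝ → ℝ} {a T : ℝ} (hf : IntegrableOn f (Ioi (a + T))) :
    IntegrableOn (fun t => f (t + T)) (Ioi a) := by
  have h := ((measurePreserving_add_right (volume : Measure ℝ) T).integrableOn_comp_preimage
    (measurableEmbedding_addRight T) (f := f) (s := Ioi (a + T))).2 hf
  simpa [Function.comp_def] using h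

section
variable {ρ μ : ℝ → ℝ} {l T h : ℝ}

theorem IsDensity.integrableOn (hρ : IsDensity ρ) {S : Set ℝ} (hS : S ⊆ Ioi 0) :
    IntegrableOn ρ S :=
  hρ.integrable.mono_set hS

theorem tail_zero (hρ : IsDensity ρ) : tail ρ 0 = 1 := hρ.integral_eq_one

theorem IsDensity.integral_Ioc_add_tail (hρ : IsDensity ρ) {a b : ℝ} (ha : 0 ≤ a) (hab : a ≤ b) :
    (∫ t in Ioc a b, ρ t) + tail ρ b = tail ρ a := by
  rw [tail, tail, ← Ioc_union_Ioi_eq_Ioi hab, setIntegral_union]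
  · exact Set.disjoint_left.2 fun x hx hx' => not_lt_of_ge hx.2 hx'
  · exact measurableSet_Ioi
  · exact hρ.integrableOn fun x hx => ha.trans_lt hx.1
  · exact hρ.integrableOn fun x hx => (ha.trans hab).trans_lt hx

theorem IsDensity.integral_Ioc (hρ : IsDensity ρ) (hT : 0 ≤ T) :
    ∫ t in Ioc 0 T, ρ t = 1 - tail ρ T := by
  have := hρ.integral_Ioc_add_tail le_rfl hT
  rw [tail_zero hρ] at this
  linarith

theorem IsDensity.tail_nonneg (hρ : IsDensity ρ) (hT : 0 ≤ T) : 0 ≤ tail ρ T :=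
  setIntegral_nonneg measurableSet_Ioi fun t ht => hρ.nonneg t (hT.trans (le_of_lt ht))

theorem IsDensity.scale (hρ : IsDensity ρ) (hl : 0 < l) : IsDensity (scale ρ l) where
  nonneg t ht := mul_nonneg hl.le (hρ.nonneg _ (by positivity))
  integrable := by
    refine Integrable.const_mul ?_ l
    exact (integrableOn_Ioi_comp_mul_left_iff ρ 0 hl).2 (by simpa using hρ.integrable)
  integral_eq_one := by
    have := integral_comp_mul_left_Ioi' ρ 0 hl
    rw [mul_zero, hρ.integral_eq_one, smul_eq_mul, ← integral_const_mul] at this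
    exact this

theorem tail_scale (hl : 0 < l) : tail (scale ρ l) T = tail ρ (l * T) := by
  have := integral_comp_mul_left_Ioi' ρ T hl
  rw [smul_eq_mul, ← integral_const_mul] at this
  exact this

theorem tail_shift : tail (shift ρ T) h = tail ρ (h + T) / tail ρ T := by
  simp only [tail, shift]
  rw [integral_div, integral_Ioi_comp_add ρ]

theorem IsDensity.shift (hρ : IsDensity ρ) (hT : 0 ≤ T) (hq : 0 < tail ρ T) :
    IsDensity (shift ρ T) where
  nonneg t ht := div_nonneg (hρ.nonneg _ (by positivity)) hq.le
  integrable := by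
    refine Integrable.div_const (integrableOn_Ioi_comp_add ?_) _
    exact hρ.integrableOn fun x (hx : 0 + T < x) => lt_of_le_of_lt (by simpa using hT) hx
  integral_eq_one := by
    have h := tail_shift (ρ := ρ) (T := T) (h := 0)
    rw [zero_add, div_self hq.ne'] at h
    exact h

theorem shift_scale (hl : 0 < l) : shift (scale ρ l) (h / l) = scale (shift ρ h) l := by
  have e : l * (h / l) = h := mul_div_cancel₀ h hl.ne'
  funext t
  simp only [shift, tail_scale hl, scale, mul_add, e]
  ring

theorem shift_shift (hq : tail ρ T ≠ 0) : shift (shift ρ T) h = shift ρ (h + T) := by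
  funext t
  simp only [shift, tail_shift]
  rw [div_div, mul_div_cancel₀ _ hq, add_assoc]

theorem scale_scale {k : ℝ} : scale (scale ρ k) l = scale ρ (k * l) := by
  funext t
  simp only [scale]
  ring_nf

theorem integral_Ioc_mul_comp_mul (f : ℝ → ℝ) (hl : 0 < l) (hh : 0 ≤ h) :
    ∫ t in Ioc 0 (h / l), l * f (l * t) = ∫ t in Ioc 0 h, f t := by
  rw [← intervalIntegral.integral_of_le hh, ← intervalIntegral.integral_of_le (by positivity),
    intervalIntegral.integral_const_mul, intervalIntegral.mul_integral_comp_mul_left, mul_zero,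
    mul_div_cancel₀ h hl.ne']

end

/-! ### Game maps and value functions -/

section
variable {Ω : Type*} {K : Set (ℝ≥0 → Ω)} {V : (K → ℝ) → Ω → ℝ} {g : Ω → ℝ}
variable {ρ μ : ℝ → ℝ} {l T h : ℝ}

theorem IsGameMap.le_add (hV : IsGameMap V) {c₁ c₂ : K → ℝ} (h₁ : IsBdd c₁) (h₂ : IsBdd c₂) {e : ℝ}
    (h : ∀ z, c₁ z ≤ c₂ z + e) (ω : Ω) : V c₁ ω ≤ V c₂ ω + e := by
  have hb : IsBdd fun z => 1 * c₂ z + e := by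
    obtain ⟨M, hM⟩ := h₂
    refine ⟨M + |e|, fun z => ?_⟩
    simp only [one_mul]
    exact (abs_add_le _ _).trans (by gcongr; exact hM z)
  have := hV.mono c₁ _ h₁ hb (fun z => by simpa using h z) ω
  rwa [hV.affine c₂ h₂ 1 e zero_le_one, one_mul] at this

/-- A game map is nonexpansive for the supremum norm. -/
theorem IsGameMap.abs_sub_le (hV : IsGameMap V) {c₁ c₂ : K → ℝ} (h₁ : IsBdd c₁) (h₂ : IsBdd c₂)
    {e : ℝ} (h : ∀ z, |c₁ z - c₂ z| ≤ e) (ω : Ω) : |V c₁ ω - V c₂ ω| ≤ e := by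
  rw [abs_sub_le_iff]
  constructor
  · have := hV.le_add h₁ h₂ (e := e) (fun z => by linarith [(abs_sub_le_iff.1 (h z)).1]) ω
    linarith
  · have := hV.le_add h₂ h₁ (e := e) (fun z => by linarith [(abs_sub_le_iff.1 (h z)).2]) ω
    linarith

theorem IsGameMap.map_const (hV : IsGameMap V) (B : ℝ) (ω : Ω) : V (fun _ => B) ω = B := by
  have := hV.affine (fun _ => 0) ⟨0, by simp⟩ 0 B le_rfl ω
  simpa using this

/-- The standing assumptions: a running payoff with values in `[0, 1]` that is measurable along
every process, and a game map satisfying the dynamic programming principle. -/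
structure IsGame (V : (K → ℝ) → Ω → ℝ) (g : Ω → ℝ) : Prop where
  mem_Icc : ∀ ω, g ω ∈ Icc (0 : ℝ) 1
  aemeasurable : ∀ z ∈ K, AEMeasurable (fun t : ℝ => g (z t.toNNReal)) (volume.restrict (Ioi 0))
  gameMap : IsGameMap V
  dynProg : DynProgPrinciple V g

theorem IsGame.integrableOn_mul (H : IsGame V g) {S : Set ℝ} (hS : S ⊆ Ioi 0)
    (hρ : IntegrableOn ρ S) (z : K) : IntegrableOn (fun t => ρ t * g (z.1 t.toNNReal)) S := by
  refine Integrable.mul_bdd (c := 1) hρ ?_ (ae_of_all _ fun t => ?_)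
  · exact ((H.aemeasurable z.1 z.2).mono_measure
      (Measure.restrict_mono hS le_rfl)).aestronglyMeasurable
  · rw [Real.norm_eq_abs, abs_le]
    constructor <;> linarith [(H.mem_Icc (z.1 t.toNNReal)).1, (H.mem_Icc (z.1 t.toNNReal)).2]

theorem IsGame.abs_setIntegral_sub_le (H : IsGame V g) {S : Set ℝ} (hS : S ⊆ Ioi 0)
    (hρ : IntegrableOn ρ S) (hμ : IntegrableOn μ S) (z : K) :
    |(∫ t in S, ρ t * g (z.1 t.toNNReal)) - ∫ t in S, μ t * g (z.1 t.toNNReal)|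
      ≤ ∫ t in S, |ρ t - μ t| := by
  rw [← integral_sub (H.integrableOn_mul hS hρ z) (H.integrableOn_mul hS hμ z)]
  refine (abs_integral_le_integral_abs).trans
    (integral_mono ?_ (hρ.sub hμ).abs fun t => ?_)
  · exact ((H.integrableOn_mul hS hρ z).sub (H.integrableOn_mul hS hμ z)).abs
  · have h := H.mem_Icc (z.1 t.toNNReal)
    simp only
    rw [← sub_mul, abs_mul, abs_of_nonneg h.1]
    exact mul_le_of_le_one_right (abs_nonneg _) h.2

theorem IsGame.payoff_mem (H : IsGame V g) (hρ : IsDensity ρ) (z : K) :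
    payoff g ρ z ∈ Icc (0 : ℝ) 1 := by
  have hg := H.mem_Icc
  constructor
  · exact setIntegral_nonneg measurableSet_Ioi fun t ht =>
      mul_nonneg (hρ.nonneg t (le_of_lt ht)) (hg _).1
  · rw [← hρ.integral_eq_one]
    refine setIntegral_mono_on (H.integrableOn_mul Subset.rfl hρ.integrable z) hρ.integrable
      measurableSet_Ioi fun t ht => ?_
    exact mul_le_of_le_one_right (hρ.nonneg t (le_of_lt ht)) (hg _).2

theorem isBdd_of_mem_Icc {X : Type*} {c : X → ℝ} (hc : ∀ x, c x ∈ Icc (0 : ℝ) 1) : IsBdd c :=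
  ⟨1, fun x => abs_le.2 ⟨by linarith [(hc x).1], (hc x).2⟩⟩

theorem IsGame.value_mem (H : IsGame V g) (hρ : IsDensity ρ) (ω : Ω) :
    value V g ρ ω ∈ Icc (0 : ℝ) 1 := by
  have hb := isBdd_of_mem_Icc (H.payoff_mem (g := g) hρ)
  have h0 := H.gameMap.mono (fun _ => 0) (payoff g ρ) ⟨0, by simp⟩ hb
    (fun z => (H.payoff_mem hρ z).1) ω
  have h1 := H.gameMap.mono (payoff g ρ) (fun _ => 1) hb ⟨1, by simp⟩
    (fun z => (H.payoff_mem hρ z).2) ω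
  rw [H.gameMap.map_const] at h0 h1
  exact ⟨h0, h1⟩

theorem IsGame.abs_value_sub_le (H : IsGame V g) (hρ : IsDensity ρ) (hμ : IsDensity μ) (ω : Ω) :
    |value V g ρ ω - value V g μ ω| ≤ ∫ t in Ioi 0, |ρ t - μ t| :=
  H.gameMap.abs_sub_le (isBdd_of_mem_Icc (H.payoff_mem hρ)) (isBdd_of_mem_Icc (H.payoff_mem hμ))
    (H.abs_setIntegral_sub_le Subset.rfl hρ.integrable hμ.integrable) ω

theorem value_congr (h : ∀ t, 0 < t → ρ t = μ t) : value V g ρ = value V g μ := by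
  unfold value payoff
  congr 1
  funext z
  exact setIntegral_congr_fun measurableSet_Ioi fun t ht => by simp only [h t ht]

/-- The payoff that collects `g` with weight `ρ` up to time `T` and then receives `q · U` of the
current state. -/
noncomputable def stagePayoff (g : Ω → ℝ) (ρ : ℝ → ℝ) (T q : ℝ) (U : Ω → ℝ) (z : K) : ℝ :=
  (∫ t in Ioc 0 T, ρ t * g (z.1 t.toNNReal)) + q * U (z.1 T.toNNReal)

theorem IsGame.isBdd_stagePayoff (H : IsGame V g) (hρ : IntegrableOn ρ (Ioc 0 T)) (q : ℝ)
    {U : Ω → ℝ} (hU : IsBdd U) : IsBdd (stagePayoff (K := K) g ρ T q U) := by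
  obtain ⟨M, hM⟩ := hU
  refine ⟨(∫ t in Ioc 0 T, |ρ t|) + |q| * M, fun z => ?_⟩
  refine (abs_add_le _ _).trans (add_le_add ?_ ?_)
  · have := H.abs_setIntegral_sub_le (fun t ht => ht.1) hρ (μ := fun _ => 0) (by simp) z
    simpa using this
  · rw [abs_mul]
    gcongr
    exact hM _

theorem IsGame.abs_stagePayoff_sub_le (H : IsGame V g) (hρ : IntegrableOn ρ (Ioc 0 T))
    (hμ : IntegrableOn μ (Ioc 0 T)) {q : ℝ} (hq : 0 ≤ q) {U W : Ω → ℝ} (hU : IsBdd U)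
    (hW : IsBdd W) {e : ℝ} (he : ∀ ω, |U ω - W ω| ≤ e) (ω : Ω) :
    |V (stagePayoff g ρ T q U) ω - V (stagePayoff g μ T q W) ω|
      ≤ (∫ t in Ioc 0 T, |ρ t - μ t|) + q * e := by
  refine H.gameMap.abs_sub_le (H.isBdd_stagePayoff hρ q hU) (H.isBdd_stagePayoff hμ q hW)
    (fun z => ?_) ω
  unfold stagePayoff
  rw [add_sub_add_comm, ← mul_sub]
  refine (abs_add_le _ _).trans (add_le_add ?_ ?_)
  · exact H.abs_setIntegral_sub_le (fun t ht => ht.1) hρ hμ z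
  · rw [abs_mul, abs_of_nonneg hq]
    gcongr
    exact he _

/-- One application of the dynamic programming principle to `scale μ l` at time `h / l`: the
running weight is replaced by the uniform one of the same mass, and the continuation value by `U`.
The error is expressed through `μ` alone, since it is invariant under scaling. -/
theorem IsGame.abs_value_scale_sub_stage_le (H : IsGame V g) (hμ : IsDensity μ) (hh : 0 < h)
    (hq : 0 < tail μ h) (hl : 0 < l) {U : Ω → ℝ} (hU : IsBdd U) {e : ℝ}
    (he : ∀ ω, |value V g (scale (shift μ h) l) ω - U ω| ≤ e) (ω : Ω) :
    |value V g (scale μ l) ω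
        - V (stagePayoff g (fun _ => (1 - tail μ h) / (h / l)) (h / l) (tail μ h) U) ω|
      ≤ (∫ t in Ioc 0 h, |μ t - (1 - tail μ h) / h|) + tail μ h * e := by
  have hT : 0 < h / l := div_pos hh hl
  have ht : tail (scale μ l) (h / l) = tail μ h := by
    rw [tail_scale hl, mul_div_cancel₀ h hl.ne']
  have hdpp := H.dynProg (scale μ l) (hμ.scale hl) (h / l) hT (by rwa [ht])
  have hval : value V g (scale μ l)
      = V (stagePayoff g (scale μ l) (h / l) (tail μ h) (value V g (scale (shift μ h) l))) := by
    rw [value, ← hdpp, ← shift_scale hl, ← ht]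
    rfl
  rw [hval]
  refine (H.abs_stagePayoff_sub_le ((hμ.scale hl).integrableOn fun t ht => ht.1) (by simp) hq.le
    (isBdd_of_mem_Icc (H.value_mem ((hμ.shift hh.le hq).scale hl))) hU he ω).trans_eq ?_
  rw [← integral_Ioc_mul_comp_mul (fun t => |μ t - (1 - tail μ h) / h|) hl hh.le]
  congr 2
  funext t
  simp only [scale]
  rw [← abs_of_pos hl, ← abs_mul, abs_of_pos hl]
  congr 1
  field_simp

end
end GameMap

namespace GameMap

/-! ### Nearly invariant state functions -/

theorem integral_abs_sub_average_le {f : ℝ → ℝ} {h η : ℝ} (hh : 0 < h)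
    (hf : IntegrableOn f (Ioc 0 h))
    (hη : ∀ x ∈ Ioc 0 h, ∀ y ∈ Ioc 0 h, |f x - f y| ≤ η) :
    ∫ t in Ioc 0 h, |f t - (∫ y in Ioc 0 h, f y) / h| ≤ h * η := by
  have hvol : (volume : Measure ℝ).real (Ioc 0 h) = h := by simp [hh.le]
  have hpt : ∀ x ∈ Ioc 0 h, |f x - (∫ y in Ioc 0 h, f y) / h| ≤ η := by
    intro x hx
    have hc : ∫ _ in Ioc 0 h, f x = h * f x := by
      rw [setIntegral_const, hvol, smul_eq_mul]
    have e : f x - (∫ y in Ioc 0 h, f y) / h = (∫ y in Ioc 0 h, (f x - f y)) / h := by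
      rw [integral_sub (by simp) hf, hc]
      field_simp
    rw [e, abs_div, abs_of_pos hh, div_le_iff₀ hh]
    have := norm_setIntegral_le_of_norm_le_const (μ := volume) (s := Ioc 0 h)
      (f := fun y => f x - f y) (by simp) (fun y hy => hη x hx y hy)
    rwa [hvol] at this
  have := norm_setIntegral_le_of_norm_le_const (μ := volume) (s := Ioc 0 h)
    (f := fun t => |f t - (∫ y in Ioc 0 h, f y) / h|) (C := η) (by simp) (fun y hy => by
      rw [Real.norm_eq_abs, abs_abs]
      exact hpt y hy)
  rw [hvol, mul_comm] at this
  exact (le_abs_self _).trans this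

section
variable {Ω : Type*} {K : Set (ℝ≥0 → Ω)} {V : (K → ℝ) → Ω → ℝ} {g : Ω → ℝ} {U : Ω → ℝ}

/-- `U` is almost a fixed point of the one-step operator that averages `g` over `[0, T]` with total
weight `p` and receives `U` at time `T` with weight `1 - p`: for large `T` the defect is `o(p)` as
`p → 0`, where the threshold for `T` may depend on `p`. No particular density is singled out. -/
def IsNearlyInvariant (V : (K → ℝ) → Ω → ℝ) (g : Ω → ℝ) (U : Ω → ℝ) : Prop :=
  ∀ ε > 0, ∃ δ > 0, ∀ p, 0 < p → p < δ → ∀ᶠ T in atTop, ∀ ω,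
    |V (stagePayoff g (fun _ => p / T) T (1 - p) U) ω - U ω| ≤ ε * p

/-- A density that is positive and continuous at `0` and each of whose shifts is proportional to
one of its scalings. The uniform, exponential and power densities are of this kind. -/
structure IsSelfSimilar (ν : ℝ → ℝ) : Prop where
  isDensity : IsDensity ν
  pos : 0 < ν 0
  continuousWithinAt : ContinuousWithinAt ν (Ici 0) 0
  similar : ∀ s, 0 < s → 0 < tail ν s → ∃ k, 0 < k ∧ ∃ C, ∀ t, 0 < t →
    shift ν s t = C * scale ν k t

theorem IsDensity.eq_of_eq_const_mul {ρ μ : ℝ → ℝ} (hρ : IsDensity ρ) (hμ : IsDensity μ) {C : ℝ}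
    (h : ∀ t, 0 < t → ρ t = C * μ t) (t : ℝ) (ht : 0 < t) : ρ t = μ t := by
  have hC : C = 1 := by
    have := hρ.integral_eq_one
    rwa [setIntegral_congr_fun measurableSet_Ioi (fun t ht => h t ht), integral_const_mul,
      hμ.integral_eq_one, mul_one] at this
  rw [h t ht, hC, one_mul]

theorem IsSelfSimilar.exists_value_eq {ν : ℝ → ℝ} (hν : IsSelfSimilar ν) {s : ℝ} (hs : 0 < s)
    (hq : 0 < tail ν s) :
    ∃ k, 0 < k ∧ ∀ l, 0 < l → value V g (scale (shift ν s) l) = value V g (scale ν (k * l)) := by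
  obtain ⟨k, hk, C, hC⟩ := hν.similar s hs hq
  refine ⟨k, hk, fun l hl => ?_⟩
  have h := (hν.isDensity.shift hs.le hq).eq_of_eq_const_mul (hν.isDensity.scale hk) hC
  rw [← scale_scale]
  refine value_congr fun t ht => ?_
  change l * shift ν s (l * t) = l * scale ν k (l * t)
  rw [h (l * t) (by positivity)]

theorem tendsto_const_mul_nhdsGT_zero {k : ℝ} (hk : 0 < k) :
    Tendsto (fun l : ℝ => k * l) (𝓝[>] 0) (𝓝[>] 0) := by
  refine tendsto_nhdsWithin_iff.2 ⟨?_, ?_⟩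
  · have : Tendsto (fun l : ℝ => k * l) (𝓝 0) (𝓝 (k * 0)) := tendsto_id.const_mul k
    rw [mul_zero] at this
    exact this.mono_left nhdsWithin_le_nhds
  · filter_upwards [self_mem_nhdsWithin] with l hl using mul_pos hk hl

theorem tendsto_const_div_atTop_nhdsGT_zero {k : ℝ} (hk : 0 < k) :
    Tendsto (fun T : ℝ => k / T) atTop (𝓝[>] 0) := by
  simpa only [div_eq_mul_inv, Function.comp_def] using
    (tendsto_const_mul_nhdsGT_zero hk).comp tendsto_inv_atTop_nhdsGT_zero

/-- If the scalings of one self-similar density have the limit `U`, then `U` is nearly invariant: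
after a time that carries a small mass `p`, the continuation is again a scaling of the same density,
so its value is close to `U`, and before that time the density is nearly constant. -/
theorem IsSelfSimilar.isNearlyInvariant {ν : ℝ → ℝ} (hν : IsSelfSimilar ν) (H : IsGame V g)
    (hU : ∀ ω, U ω ∈ Icc (0 : ℝ) 1) (hlim : ScaleLimit V g ν U) : IsNearlyInvariant V g U := by
  intro ε hε
  have hν0 := hν.pos
  have hd := hν.isDensity
  -- The oscillation `η` is chosen so that `2 * η ≤ ε / 2 * (ν 0 - η)`.
  obtain ⟨η, hη, hηlt, hηε⟩ : ∃ η > 0, η < ν 0 ∧ 2 * η ≤ ε / 2 * (ν 0 - η) := by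
    refine ⟨ε * ν 0 / (4 + ε), by positivity, ?_, le_of_eq ?_⟩
    · rw [div_lt_iff₀ (by positivity)]
      nlinarith
    · field_simp
      ring
  obtain ⟨r₀, hr₀, hr⟩ := Metric.continuousWithinAt_iff.1 hν.continuousWithinAt η hη
  have hclose : ∀ t ∈ Icc 0 (r₀ / 2), |ν t - ν 0| ≤ η := fun t ht => by
    refine (hr (x := t) ht.1 ?_).le
    rw [Real.dist_eq, sub_zero, abs_of_nonneg ht.1]
    linarith [ht.2]
  have hr2 : 0 < r₀ / 2 := by positivity
  generalize r₀ / 2 = r at hclose hr2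
  have hint : ∀ s, IntegrableOn ν (Ioc 0 s) := fun s => hd.integrableOn fun t ht => ht.1
  have hlow : ∀ s, 0 ≤ s → s ≤ r → s * (ν 0 - η) ≤ ∫ t in Ioc 0 s, ν t := by
    intro s hs hsr
    have := setIntegral_mono_on (μ := volume) (s := Ioc 0 s) (f := fun _ => ν 0 - η) (g := ν)
      (by simp) (hint s) measurableSet_Ioc fun t ht => by
        linarith [(abs_le.1 (hclose t ⟨ht.1.le, ht.2.trans hsr⟩)).1]
    simpa [hs] using this
  refine ⟨∫ t in Ioc 0 r, ν t, lt_of_lt_of_le (mul_pos hr2 (by linarith)) (hlow r hr2.le le_rfl),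
    fun p hp hpδ => ?_⟩
  obtain ⟨s, hs, hsp⟩ : ∃ s ∈ Icc 0 r, ∫ t in Ioc 0 s, ν t = p := by
    have hc : ContinuousOn (fun s => ∫ t in Ioc 0 s, ν t) (Icc 0 r) :=
      intervalIntegral.continuousOn_primitive
        ((integrableOn_Icc_iff_integrableOn_Ioc (by simp)).2 (hint r))
    exact intermediate_value_Icc hr2.le hc ⟨by simpa using hp.le, hpδ.le⟩
  have hs0 : 0 < s := by
    rcases hs.1.eq_or_lt with h | h
    · rw [← h] at hsp
      simp at hsp
      linarith
    · exact h
  have htail : tail ν s = 1 - p := by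
    have := hd.integral_Ioc hs.1
    linarith
  have hq : 0 < tail ν s := by
    have h1 := hd.integral_Ioc hr2.le
    have h2 := hd.tail_nonneg hr2.le
    linarith
  obtain ⟨k, hk, hkv⟩ := hν.exists_value_eq (V := V) (g := g) hs0 hq
  have hosc : ∫ t in Ioc 0 s, |ν t - p / s| ≤ ε / 2 * p := by
    rw [← hsp]
    refine (integral_abs_sub_average_le hs0 (hint s) (η := 2 * η) fun x hx y hy => ?_).trans ?_
    · have h1 := hclose x ⟨hx.1.le, hx.2.trans hs.2⟩
      have h2 := hclose y ⟨hy.1.le, hy.2.trans hs.2⟩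
      rw [abs_le] at *
      constructor <;> linarith
    · have h1 := hlow s hs.1 hs.2
      calc s * (2 * η) ≤ s * (ε / 2 * (ν 0 - η)) := by gcongr
        _ = ε / 2 * (s * (ν 0 - η)) := by ring
        _ ≤ _ := by gcongr
  have hev := Metric.tendstoUniformly_iff.1 hlim (ε * p / 4) (by positivity)
  have hev' := (tendsto_const_mul_nhdsGT_zero hk).eventually hev
  filter_upwards [(tendsto_const_div_atTop_nhdsGT_zero hs0).eventually (hev.and hev'),
    eventually_gt_atTop 0] with T hT hT0 ω
  have hl : 0 < s / T := by positivity
  have hsT : s / (s / T) = T := by field_simp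
  have hstep := H.abs_value_scale_sub_stage_le hd hs0 hq hl (isBdd_of_mem_Icc hU)
    (e := ε * p / 4) (fun ω => by
      rw [hkv _ hl, abs_sub_comm]
      exact (hT.2 ω).le) ω
  have h2 := (hT.1 ω).le
  rw [htail, hsT, sub_sub_cancel] at hstep
  rw [Real.dist_eq] at h2
  have h3 : (1 - p) * (ε * p / 4) ≤ ε * p / 4 := mul_le_of_le_one_left (by positivity) (by linarith)
  have h4 := abs_sub_le_iff.1 h2
  have h5 := abs_sub_le_iff.1 hstep
  rw [abs_le]
  constructor <;> linarith

/-! ### Backward induction along a density -/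

/-- For all small `l`, the value of `scale μ l` is within `e` of `U`. -/
def HasLimitError (V : (K → ℝ) → Ω → ℝ) (g : Ω → ℝ) (U : Ω → ℝ) (μ : ℝ → ℝ) (e : ℝ) : Prop :=
  ∀ᶠ l in 𝓝[>] (0 : ℝ), ∀ ω, |value V g (scale μ l) ω - U ω| ≤ e

theorem scaleLimit_of_hasLimitError {μ : ℝ → ℝ} (h : ∀ e > 0, HasLimitError V g U μ e) :
    ScaleLimit V g μ U := by
  refine Metric.tendstoUniformly_iff.2 fun e he => ?_
  filter_upwards [h (e / 2) (by positivity)] with l hl ω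
  rw [Real.dist_eq, abs_sub_comm]
  linarith [hl ω]

/-- One backward step: the hypothesis `hp` is near invariance of `U` for the weight `p`, which is the
mass that `μ` spends before time `h`. -/
theorem HasLimitError.of_shift (H : IsGame V g) (hU : ∀ ω, U ω ∈ Icc (0 : ℝ) 1) {ε p : ℝ}
    (hp : ∀ᶠ T in atTop, ∀ ω,
      |V (stagePayoff g (fun _ => p / T) T (1 - p) U) ω - U ω| ≤ ε * p)
    {μ : ℝ → ℝ} (hμ : IsDensity μ) {h : ℝ} (hh : 0 < h) (hq : 0 < tail μ h)
    (hpq : p = 1 - tail μ h) {e : ℝ} (he : HasLimitError V g U (shift μ h) e) :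
    HasLimitError V g U μ ((∫ t in Ioc 0 h, |μ t - p / h|) + tail μ h * e + ε * p) := by
  subst hpq
  have hT : Tendsto (fun l : ℝ => h / l) (𝓝[>] 0) atTop := by
    simpa only [div_eq_mul_inv] using tendsto_inv_nhdsGT_zero.const_mul_atTop hh
  filter_upwards [he, hT.eventually hp, self_mem_nhdsWithin] with l hl hl' hl0 ω
  have h1 := H.abs_value_scale_sub_stage_le hμ hh hq hl0 (isBdd_of_mem_Icc hU) hl ω
  have h2 := hl' ω
  rw [sub_sub_cancel] at h2
  exact (abs_sub_le _ _ _).trans (add_le_add h1 h2)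

/-- Backward induction on a grid of step `h` that ends at time `L`. The error at time `L` is
trivially at most `1`; each step adds the oscillation of `μ` and `ε` times the mass of the step,
both relative to the remaining mass. -/
theorem hasLimitError_shift_grid (H : IsGame V g) (hU : ∀ ω, U ω ∈ Icc (0 : ℝ) 1) {ε δ : ℝ}
    (hδ : ∀ p, 0 < p → p < δ → ∀ᶠ T in atTop, ∀ ω,
      |V (stagePayoff g (fun _ => p / T) T (1 - p) U) ω - U ω| ≤ ε * p)
    {μ : ℝ → ℝ} (hμ : IsDensity μ) {L h η : ℝ} (hh : 0 < h) (hL : 0 < tail μ L)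
    (hosc : ∀ x ∈ Icc 0 L, ∀ y ∈ Icc 0 L, |x - y| ≤ h → |μ x - μ y| ≤ η)
    (hstep : ∀ t, 0 ≤ t → t + h ≤ L →
      0 < ∫ x in Ioc t (t + h), μ x ∧ ∫ x in Ioc t (t + h), μ x < δ * tail μ L)
    (j : ℕ) (hj : j * h ≤ L) :
    HasLimitError V g U (shift μ (L - j * h))
      ((tail μ L + j * (h * η) + ε * (tail μ (L - j * h) - tail μ L)) / tail μ (L - j * h)) := by
  induction j with
  | zero =>
    have hL0 : 0 ≤ L := by simpa using hj
    simp only [Nat.cast_zero, zero_mul, sub_zero, sub_self, mul_zero, add_zero, div_self hL.ne']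
    filter_upwards [self_mem_nhdsWithin] with l hl ω
    have h1 := H.value_mem ((hμ.shift hL0 hL).scale hl) ω
    have h2 := hU ω
    rw [abs_le]
    constructor <;> linarith [h1.1, h1.2, h2.1, h2.2]
  | succ j ih =>
    push_cast at hj ⊢
    have hjh : 0 ≤ (j : ℝ) * h := by positivity
    specialize ih (by linarith)
    obtain ⟨t, ht⟩ : ∃ t, t = L - (j + 1) * h := ⟨_, rfl⟩
    have hth : L - j * h = h + t := by rw [ht]; ring
    have ht0 : 0 ≤ t := by linarith
    rw [hth] at ih
    rw [← ht]
    obtain ⟨hm0, hmδ⟩ := hstep t ht0 (by linarith)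
    have hsum := hμ.integral_Ioc_add_tail ht0 (by linarith : t ≤ t + h)
    rw [add_comm t h] at hsum hm0 hmδ
    have hmono : tail μ L ≤ tail μ (h + t) := by
      have := hμ.integral_Ioc_add_tail (by linarith : 0 ≤ h + t) (by linarith : h + t ≤ L)
      have h0 : 0 ≤ ∫ x in Ioc (h + t) L, μ x :=
        setIntegral_nonneg measurableSet_Ioc fun x hx => hμ.nonneg x (by linarith [hx.1])
      linarith
    have hqt : 0 < tail μ t := by linarith
    have hd := hμ.shift ht0 hqt
    have htl : tail (shift μ t) h = tail μ (h + t) / tail μ t := tail_shift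
    obtain ⟨p, hp⟩ : ∃ p, p = 1 - tail (shift μ t) h := ⟨_, rfl⟩
    have hpm : p = (∫ x in Ioc t (h + t), μ x) / tail μ t := by
      rw [hp, htl, eq_div_iff hqt.ne', sub_mul, div_mul_cancel₀ _ hqt.ne']
      linarith
    have hδ0 : 0 < δ := pos_of_mul_pos_left (hm0.trans hmδ) hL.le
    have hpδ : p < δ := by
      rw [hpm, div_lt_iff₀ hqt]
      refine hmδ.trans_le ?_
      gcongr
      linarith
    have hqh : 0 < tail (shift μ t) h := by
      rw [htl]
      exact div_pos (by linarith) hqt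
    rw [← shift_shift hqt.ne'] at ih
    have hkey := HasLimitError.of_shift H hU (hδ p (by rw [hpm]; positivity) hpδ) hd hh hqh hp ih
    have hosc' : ∫ x in Ioc 0 h, |shift μ t x - p / h| ≤ h * (η / tail μ t) := by
      rw [hp, ← hd.integral_Ioc hh.le]
      refine integral_abs_sub_average_le hh (hd.integrableOn fun x hx => hx.1) fun x hx y hy => ?_
      simp only [shift]
      rw [← sub_div, abs_div, abs_of_pos hqt]
      gcongr
      refine hosc _ ⟨by linarith [hx.1], by linarith [hx.2]⟩ _
        ⟨by linarith [hy.1], by linarith [hy.2]⟩ ?_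
      rw [abs_le]
      constructor <;> linarith [hx.1, hx.2, hy.1, hy.2]
    refine hkey.mono fun l hl ω => (hl ω).trans ?_
    have hpos : 0 < tail μ (h + t) := by linarith
    rw [htl, hpm] at *
    calc _ ≤ h * (η / tail μ t) + tail μ (h + t) / tail μ t *
          ((tail μ L + j * (h * η) + ε * (tail μ (h + t) - tail μ L)) / tail μ (h + t))
          + ε * ((∫ x in Ioc t (h + t), μ x) / tail μ t) := by gcongr
      _ = _ := by
        rw [← hsum]
        field_simp
        ring

end
end GameMap

namespace GameMap

/-! ### From near invariance to scaling limits of all densities -/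

theorem IsDensity.tendsto_tail {μ : ℝ → ℝ} (hμ : IsDensity μ) :
    Tendsto (tail μ) atTop (𝓝 0) := by
  have h := (intervalIntegral_tendsto_integral_Ioi 0 hμ.integrable tendsto_id).const_sub 1
  rw [hμ.integral_eq_one, sub_self] at h
  refine h.congr' ?_
  filter_upwards [eventually_ge_atTop 0] with T hT
  simp only [id]
  rw [intervalIntegral.integral_of_le hT, hμ.integral_Ioc hT, sub_sub_cancel]

theorem exists_continuous_pos_density_near {μ : ℝ → ℝ} (hμ : IsDensity μ) {ε : ℝ} (hε : 0 < ε) :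
    ∃ μ' : ℝ → ℝ, IsDensity μ' ∧ Continuous μ' ∧ (∀ t, 0 < μ' t) ∧
      ∫ t in Ioi 0, |μ t - μ' t| ≤ ε := by
  have hint : Integrable ((Ioi 0).indicator μ) :=
    hμ.integrable.integrable_indicator measurableSet_Ioi
  obtain ⟨f, -, hfd, hfc, hfi⟩ :=
    hint.exists_hasCompactSupport_integral_sub_le (ε := ε / 4) (by positivity)
  have hexp : IntegrableOn (fun t : ℝ => Real.exp (-t)) (Ioi 0) := integrableOn_exp_neg_Ioi 0
  -- A positive continuous function near `μ`: its mass is near `1`, so normalizing it moves it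
  -- little.
  obtain ⟨F, hF⟩ : ∃ F : ℝ → ℝ, F = fun t => max (f t) 0 + ε / 4 * Real.exp (-t) := ⟨_, rfl⟩
  have hFc : Continuous F := by
    rw [hF]
    fun_prop
  have hFpos : ∀ t, 0 < F t := fun t => by
    rw [hF]
    have := le_max_right (f t) 0
    positivity
  have hFi : IntegrableOn F (Ioi 0) := by
    rw [hF]
    exact (hfi.integrableOn.pos_part).add (hexp.const_mul _)
  have hdiff : IntegrableOn (fun t => |μ t - f t|) (Ioi 0) :=
    (hμ.integrable.sub hfi.integrableOn).abs
  have hμF : ∫ t in Ioi 0, |μ t - F t| ≤ ε / 2 := by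
    have hfd' : ∫ t in Ioi 0, |μ t - f t| ≤ ε / 4 := by
      refine le_trans ?_ hfd
      rw [← integral_indicator measurableSet_Ioi]
      refine integral_mono ?_ (hint.sub hfi).norm fun t => ?_
      · exact (hdiff.integrable_indicator measurableSet_Ioi)
      · by_cases ht : t ∈ Ioi (0 : ℝ)
        · simp only [indicator_of_mem ht, Real.norm_eq_abs, le_refl]
        · simp only [indicator_of_notMem ht]
          exact norm_nonneg _
    calc ∫ t in Ioi 0, |μ t - F t|
        ≤ ∫ t in Ioi 0, (|μ t - f t| + ε / 4 * Real.exp (-t)) := by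
          refine setIntegral_mono_on (hμ.integrable.sub hFi).abs
            (hdiff.add (hexp.const_mul _)) measurableSet_Ioi
            fun t ht => ?_
          have h0 := hμ.nonneg t (le_of_lt ht)
          have h1 : |μ t - max (f t) 0| ≤ |μ t - f t| := by
            have := abs_max_sub_max_le_abs (μ t) (f t) 0
            rwa [max_eq_left h0] at this
          have h2 : 0 < ε / 4 * Real.exp (-t) := by positivity
          rw [hF]
          calc |μ t - (max (f t) 0 + ε / 4 * Real.exp (-t))|
              = |(μ t - max (f t) 0) + -(ε / 4 * Real.exp (-t))| := by ring_nf
            _ ≤ _ := (abs_add_le _ _).trans (by rw [abs_neg, abs_of_pos h2]; gcongr)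
      _ = (∫ t in Ioi 0, |μ t - f t|) + ε / 4 := by
          rw [integral_add hdiff (hexp.const_mul _), integral_const_mul,
            integral_exp_neg_Ioi_zero, mul_one]
      _ ≤ ε / 2 := by linarith
  obtain ⟨I, hI⟩ : ∃ I, I = ∫ t in Ioi 0, F t := ⟨_, rfl⟩
  have hIpos : 0 < I := by
    rw [hI, setIntegral_pos_iff_support_of_nonneg_ae (ae_of_all _ fun t => (hFpos t).le) hFi]
    have : Function.support F = univ := by
      ext t
      simp [(hFpos t).ne']
    rw [this, univ_inter]
    simp
  have hI1 : |I - 1| ≤ ε / 2 := by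
    rw [hI, ← hμ.integral_eq_one, abs_sub_comm, ← integral_sub hμ.integrable hFi]
    exact abs_integral_le_integral_abs.trans hμF
  have hd : IsDensity fun t => F t / I := by
    refine ⟨fun t _ => (div_pos (hFpos t) hIpos).le, hFi.div_const _, ?_⟩
    rw [integral_div, ← hI, div_self hIpos.ne']
  refine ⟨fun t => F t / I, hd, hFc.div_const _, fun t => div_pos (hFpos t) hIpos, ?_⟩
  have hnorm : ∫ t in Ioi 0, |F t - F t / I| = |I - 1| := by
    have : ∀ t, |F t - F t / I| = |I - 1| * (F t / I) := fun t => by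
      rw [← abs_of_pos (div_pos (hFpos t) hIpos), ← abs_mul, abs_of_pos (div_pos (hFpos t) hIpos)]
      congr 1
      field_simp
    simp_rw [this]
    rw [integral_const_mul, hd.integral_eq_one, mul_one]
  have h1 : IntegrableOn (fun t => |μ t - F t|) (Ioi 0) := (hμ.integrable.sub hFi).abs
  have h2 : IntegrableOn (fun t => |F t - F t / I|) (Ioi 0) := (hFi.sub hd.integrable).abs
  calc ∫ t in Ioi 0, |μ t - F t / I|
      ≤ ∫ t in Ioi 0, (|μ t - F t| + |F t - F t / I|) :=
        integral_mono (hμ.integrable.sub hd.integrable).abs (h1.add h2) fun t =>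
          abs_sub_le _ _ _
    _ = (∫ t in Ioi 0, |μ t - F t|) + |I - 1| := by
        rw [integral_add h1 h2, hnorm]
    _ ≤ ε := by linarith

section
variable {Ω : Type*} {K : Set (ℝ≥0 → Ω)} {V : (K → ℝ) → Ω → ℝ} {g : Ω → ℝ} {U : Ω → ℝ}

theorem IsNearlyInvariant.hasLimitError_of_continuous (hN : IsNearlyInvariant V g U)
    (H : IsGame V g) (hU : ∀ ω, U ω ∈ Icc (0 : ℝ) 1) {μ : ℝ → ℝ} (hμ : IsDensity μ)
    (hc : Continuous μ) (hpos : ∀ t, 0 < μ t) {e : ℝ} (he : 0 < e) : HasLimitError V g U μ e := by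
  obtain ⟨δ, hδ, hδV⟩ := hN (e / 3) (by positivity)
  obtain ⟨L, hLe, hL⟩ := ((hμ.tendsto_tail.eventually (ge_mem_nhds (by positivity : 0 < e / 3))).and
    (eventually_gt_atTop 0)).exists
  have hint : ∀ {S : Set ℝ}, S ⊆ Ioi 0 → IntegrableOn μ S := fun hS => hμ.integrableOn hS
  have hintpos : ∀ a b : ℝ, 0 ≤ a → a < b → 0 < ∫ x in Ioc a b, μ x := by
    intro a b ha hab
    rw [setIntegral_pos_iff_support_of_nonneg_ae (ae_of_all _ fun t => (hpos t).le)
      (hint fun x hx => ha.trans_lt hx.1)]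
    have : Function.support μ = univ := by
      ext t
      simp [(hpos t).ne']
    rw [this, univ_inter]
    simpa using hab
  have hqL : 0 < tail μ L := by
    have h1 := hμ.integral_Ioc_add_tail hL.le (by linarith : L ≤ L + 1)
    have h2 := hintpos L (L + 1) hL.le (by linarith)
    have h3 := hμ.tail_nonneg (by linarith : 0 ≤ L + 1)
    linarith
  obtain ⟨M, hM⟩ := isCompact_Icc.exists_bound_of_continuousOn (hc.continuousOn (s := Icc 0 L))
  obtain ⟨d, hd, hdμ⟩ := Metric.uniformContinuousOn_iff.1
    (isCompact_Icc.uniformContinuousOn_of_continuous (hc.continuousOn (s := Icc 0 L)))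
    (e / (3 * L)) (by positivity)
  have hM0 : 0 ≤ M := (norm_nonneg _).trans (hM 0 ⟨le_rfl, hL.le⟩)
  -- The mesh is fine enough for the modulus of continuity and for the mass of every step.
  obtain ⟨n, hn0, hnd, hnM⟩ : ∃ n : ℕ, 0 < n ∧ L / n < d ∧ L / n * M < δ * tail μ L := by
    have h1 : Tendsto (fun n : ℕ => L / n) atTop (𝓝 0) := tendsto_const_div_atTop_nhds_zero_nat L
    have h2 : Tendsto (fun n : ℕ => L / n * M) atTop (𝓝 0) := by simpa using h1.mul_const M
    obtain ⟨n, hn⟩ := ((eventually_gt_atTop 0).and ((h1.eventually (gt_mem_nhds hd)).and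
      (h2.eventually (gt_mem_nhds (mul_pos hδ hqL))))).exists
    exact ⟨n, hn⟩
  have hn : (0 : ℝ) < n := by exact_mod_cast hn0
  have hh : 0 < L / n := by positivity
  have hnL : (n : ℝ) * (L / n) = L := mul_div_cancel₀ L hn.ne'
  have hgrid := hasLimitError_shift_grid H hU hδV hμ (L := L) (h := L / n) (η := e / (3 * L)) hh hqL
    (fun x hx y hy hxy => (hdμ x hx y hy (lt_of_le_of_lt hxy hnd)).le)
    (fun t ht htL => by
      refine ⟨hintpos _ _ ht (by linarith), lt_of_le_of_lt ?_ hnM⟩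
      have h1 := setIntegral_mono_on (μ := volume) (s := Ioc t (t + L / n)) (f := μ)
        (g := fun _ => M) (hint fun x hx => ht.trans_lt hx.1) (by simp) measurableSet_Ioc
        fun x hx => (le_abs_self _).trans (hM x ⟨by linarith [hx.1], by linarith [hx.2]⟩)
      simpa [hh.le] using h1) n hnL.le
  have hshift : shift μ 0 = μ := by
    funext t
    simp [shift, tail_zero hμ]
  rw [hnL, sub_self, hshift, tail_zero hμ, div_one, ← mul_assoc, hnL] at hgrid
  refine hgrid.mono fun l hl ω => (hl ω).trans ?_
  have e1 : L * (e / (3 * L)) = e / 3 := by field_simp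
  have e2 : e / 3 * (1 - tail μ L) ≤ e / 3 := mul_le_of_le_one_right (by positivity) (by linarith)
  rw [e1]
  linarith

/-- Values depend continuously on the density in `L¹`, uniformly under scaling, so the continuous
positive case suffices. -/
theorem IsNearlyInvariant.scaleLimit (hN : IsNearlyInvariant V g U) (H : IsGame V g)
    (hU : ∀ ω, U ω ∈ Icc (0 : ℝ) 1) {μ : ℝ → ℝ} (hμ : IsDensity μ) : ScaleLimit V g μ U := by
  refine scaleLimit_of_hasLimitError fun e he => ?_
  obtain ⟨μ', hμ', hc, hpos, hdist⟩ :=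
    exists_continuous_pos_density_near hμ (ε := e / 2) (by positivity)
  filter_upwards [hN.hasLimitError_of_continuous H hU hμ' hc hpos (e := e / 2) (by positivity),
    self_mem_nhdsWithin] with l hl hl0 ω
  have h1 := H.abs_value_sub_le (hμ.scale hl0) (hμ'.scale hl0) ω
  have h2 : ∫ t in Ioi 0, |scale μ l t - scale μ' l t| = ∫ t in Ioi 0, |μ t - μ' t| := by
    have := integral_comp_mul_left_Ioi' (fun t => |μ t - μ' t|) 0 (b := l) hl0
    rw [mul_zero, smul_eq_mul, ← integral_const_mul] at this
    rw [← this]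
    congr 1
    funext t
    simp only [scale]
    rw [← mul_sub, abs_mul, abs_of_pos hl0]
  rw [h2] at h1
  have := abs_sub_le (value V g (scale μ l) ω) (value V g (scale μ' l) ω) (U ω)
  linarith [hl ω]

/-! ### The uniform, exponential and power densities -/

theorem isDensity_uniformDensity_one : IsDensity (uniformDensity 1) where
  nonneg t _ := indicator_nonneg (fun _ _ => by norm_num) t
  integrable := by
    refine IntegrableOn.integrable_indicator ?_ measurableSet_Icc |>.integrableOn
    simp
  integral_eq_one := by
    have h : Ioi (0 : ℝ) ∩ Icc 0 1 = Ioc 0 1 := by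
      ext x
      simp only [mem_inter_iff, mem_Ioi, mem_Icc, mem_Ioc]
      exact ⟨fun h => ⟨h.1, h.2.2⟩, fun h => ⟨h.1, h.1.le, h.2⟩⟩
    rw [uniformDensity, MeasureTheory.setIntegral_indicator measurableSet_Icc, h]
    simp

theorem isSelfSimilar_uniformDensity : IsSelfSimilar (uniformDensity 1) where
  isDensity := isDensity_uniformDensity_one
  pos := by simp [uniformDensity]
  continuousWithinAt := by
    refine (continuousWithinAt_const (b := (1 : ℝ))).congr_of_eventuallyEq ?_
      (by simp [uniformDensity])
    filter_upwards [inter_mem_nhdsWithin (Ici (0 : ℝ)) (Iio_mem_nhds zero_lt_one)] with t ht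
    have : t ∈ Icc (0 : ℝ) 1 := ⟨ht.1, le_of_lt ht.2⟩
    simp [uniformDensity, this]
  similar s hs hq := by
    have hs1 : s < 1 := by
      by_contra! h
      have : tail (uniformDensity 1) s = 0 := by
        refine setIntegral_eq_zero_of_forall_eq_zero fun t ht => indicator_of_notMem ?_ _
        exact fun h' => absurd h'.2 (not_le.2 (h.trans_lt ht))
      linarith
    have h1 : 0 < 1 - s := by linarith
    refine ⟨1 / (1 - s), by positivity, (1 - s) / tail (uniformDensity 1) s, fun t ht => ?_⟩
    have hiff : t + s ∈ Icc (0 : ℝ) 1 ↔ 1 / (1 - s) * t ∈ Icc (0 : ℝ) 1 := by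
      have h2 : 0 ≤ 1 / (1 - s) * t := by positivity
      rw [mem_Icc, mem_Icc, and_iff_right h2, and_iff_right (by positivity), one_div,
        inv_mul_le_iff₀ h1]
      constructor <;> intro <;> linarith
    by_cases h : t + s ∈ Icc (0 : ℝ) 1
    · simp only [shift, scale, uniformDensity, indicator_of_mem h, indicator_of_mem (hiff.1 h)]
      field_simp
    · simp only [shift, scale, uniformDensity, indicator_of_notMem h,
        indicator_of_notMem (fun h' => h (hiff.2 h'))]
      simp

theorem uniformDensity_eq_scale {T : ℝ} (hT : 0 < T) :
    uniformDensity T = scale (uniformDensity 1) T⁻¹ := by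
  funext t
  have hiff : t ∈ Icc 0 T ↔ T⁻¹ * t ∈ Icc (0 : ℝ) 1 := by
    rw [mem_Icc, mem_Icc, inv_mul_le_iff₀ hT, mul_one, mul_nonneg_iff_of_pos_left (inv_pos.2 hT)]
  by_cases h : t ∈ Icc 0 T
  · simp only [scale, uniformDensity, indicator_of_mem h, indicator_of_mem (hiff.1 h)]
    simp
  · simp only [scale, uniformDensity, indicator_of_notMem h,
      indicator_of_notMem (fun h' => h (hiff.2 h'))]
    simp

theorem cesaroLimit_iff_scaleLimit :
    CesaroLimit V g U ↔ ScaleLimit V g (uniformDensity 1) U := by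
  unfold CesaroLimit ScaleLimit
  simp only [Metric.tendstoUniformly_iff]
  refine forall₂_congr fun e he => ⟨fun h => ?_, fun h => ?_⟩
  · filter_upwards [tendsto_inv_nhdsGT_zero.eventually h, self_mem_nhdsWithin] with l hl hl0
    rwa [uniformDensity_eq_scale (inv_pos.2 hl0), inv_inv] at hl
  · filter_upwards [tendsto_inv_atTop_nhdsGT_zero.eventually h, eventually_gt_atTop 0] with T hT hT0
    rwa [uniformDensity_eq_scale hT0]

theorem expDensity_eq_scale (l : ℝ) : expDensity l = scale (expDensity 1) l := by
  funext t
  simp [expDensity, scale]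

theorem continuous_expDensity : Continuous (expDensity 1) := by
  unfold expDensity
  fun_prop

theorem isSelfSimilar_expDensity : IsSelfSimilar (expDensity 1) where
  isDensity := by
    refine ⟨fun t _ => ?_, ?_, ?_⟩
    · simp only [expDensity]
      positivity
    · have h : expDensity 1 = fun t => Real.exp (-t) := by
        funext t
        simp [expDensity]
      exact h ▸ integrableOn_exp_neg_Ioi 0
    · simpa [expDensity] using integral_exp_neg_Ioi_zero
  pos := by simp [expDensity]
  continuousWithinAt := continuous_expDensity.continuousWithinAt
  similar s _ _ := by
    refine ⟨1, one_pos, Real.exp (-s) / tail (expDensity 1) s, fun t _ => ?_⟩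
    simp only [shift, scale, expDensity, one_mul]
    rw [show -1 * (t + s) = -s + -1 * t by ring, Real.exp_add]
    ring

theorem abelLimit_iff_scaleLimit : AbelLimit V g U ↔ ScaleLimit V g (expDensity 1) U := by
  unfold AbelLimit ScaleLimit
  simp only [← expDensity_eq_scale]

/-- Shifting a power density by `T` amounts, up to normalization, to scaling it by
`α / (α + β T)`. -/
theorem shift_eq_const_mul_scale_of_power {ρ : ℝ → ℝ} {α β γ : ℝ} (hα : 0 < α) (hβ : 0 < β)
    (hρ : ∀ t, 0 ≤ t → ρ t = 1 / (α + β * t) ^ γ) {T : ℝ} (hT : 0 ≤ T) :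
    ∃ C, ∀ t, 0 < t → shift ρ T t = C * scale ρ (α / (α + β * T)) t := by
  have hd : 0 < α + β * T := by positivity
  obtain ⟨k, hk⟩ : ∃ k, k = α / (α + β * T) := ⟨_, rfl⟩
  have hk0 : 0 < k := by rw [hk]; positivity
  refine ⟨k ^ γ / k / tail ρ T, fun t ht => ?_⟩
  rw [← hk]
  have hx : 0 < α + β * (t + T) := by positivity
  have hkx : α + β * (k * t) = k * (α + β * (t + T)) := by
    rw [hk]
    field_simp
    ring
  have hkγ : k ^ γ ≠ 0 := (Real.rpow_pos_of_pos hk0 γ).ne'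
  have hxγ : (α + β * (t + T)) ^ γ ≠ 0 := (Real.rpow_pos_of_pos hx γ).ne'
  simp only [shift, scale]
  rw [hρ _ (by positivity), hρ _ (by positivity), hkx, Real.mul_rpow hk0.le hx.le]
  field_simp

theorem IsDensity.tail_pos {ρ : ℝ → ℝ} (hρ : IsDensity ρ) (hpos : ∀ t, 0 ≤ t → 0 < ρ t) {T : ℝ}
    (hT : 0 ≤ T) : 0 < tail ρ T := by
  rw [tail, setIntegral_pos_iff_support_of_nonneg_ae
    (ae_restrict_of_forall_mem measurableSet_Ioi fun t ht => hρ.nonneg t (hT.trans (le_of_lt ht)))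
    (hρ.integrableOn fun t ht => lt_of_le_of_lt hT ht)]
  have : Function.support ρ ∩ Ioi T = Ioi T :=
    inter_eq_right.2 fun t ht => (hpos t (hT.trans (le_of_lt ht))).ne'
  rw [this]
  simp

theorem IsPowerDensity.isSelfSimilar {ρ : ℝ → ℝ} (hρ : IsPowerDensity ρ) : IsSelfSimilar ρ := by
  obtain ⟨hd, α, β, γ, hα, hβ, hγ, h⟩ := hρ
  refine ⟨hd, ?_, ?_, fun s hs _ => ?_⟩
  · rw [h 0 le_rfl]
    have : 0 < α + β * 0 := by simpa using hα
    positivity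
  · have hc : ContinuousAt (fun t => 1 / (α + β * t) ^ γ) 0 := by
      have h0 : α + β * 0 ≠ 0 := by simpa using hα.ne'
      refine ContinuousAt.div continuousAt_const
        (ContinuousAt.rpow_const (by fun_prop) (Or.inl h0)) ?_
      have : 0 < α + β * 0 := by simpa using hα
      positivity
    exact hc.continuousWithinAt.congr (fun t ht => h t ht) (h 0 le_rfl)
  · exact ⟨_, by positivity, shift_eq_const_mul_scale_of_power hα hβ h hs.le⟩

theorem IsPowerDensity.shiftLimit_iff_scaleLimit {ρ : ℝ → ℝ} (hρ : IsPowerDensity ρ) :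
    ShiftLimit V g ρ U ↔ ScaleLimit V g ρ U := by
  obtain ⟨hd, α, β, γ, hα, hβ, hγ, h⟩ := hρ
  have hpos : ∀ t, 0 ≤ t → 0 < ρ t := fun t ht => by
    rw [h t ht]
    positivity
  have key : ∀ T, 0 ≤ T →
      value V g (shift ρ T) = value V g (scale ρ (α / (α + β * T))) := fun T hT => by
    obtain ⟨C, hC⟩ := shift_eq_const_mul_scale_of_power hα hβ h hT
    exact value_congr ((hd.shift hT (hd.tail_pos hpos hT)).eq_of_eq_const_mul
      (hd.scale (by positivity)) hC)
  unfold ShiftLimit ScaleLimit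
  simp only [Metric.tendstoUniformly_iff]
  refine forall₂_congr fun e he => ⟨fun hs => ?_, fun hs => ?_⟩
  · have hT : Tendsto (fun l : ℝ => (α / l - α) / β) (𝓝[>] 0) atTop := by
      refine Tendsto.atTop_div_const hβ (tendsto_atTop_add_const_right _ (-α) ?_)
      exact tendsto_inv_nhdsGT_zero.const_mul_atTop hα
    filter_upwards [hT.eventually hs, hT.eventually (eventually_ge_atTop 0),
      self_mem_nhdsWithin] with l hl hl' (hl0 : 0 < l)
    rw [key _ hl'] at hl
    -- The shift was chosen so that it amounts to the scale `l`.
    have : α / (α + β * ((α / l - α) / β)) = l := by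
      field_simp
      ring
    rwa [this] at hl
  · have hk : Tendsto (fun T : ℝ => α / (α + β * T)) atTop (𝓝[>] 0) :=
      (tendsto_const_div_atTop_nhdsGT_zero hα).comp
        (tendsto_atTop_add_const_left _ α (tendsto_id.const_mul_atTop hβ))
    filter_upwards [hk.eventually hs, eventually_ge_atTop 0] with T hT hT0
    rwa [key T hT0]

theorem exists_isPowerDensity : ∃ ρ, IsPowerDensity ρ := by
  have hpow : ∀ t : ℝ, 0 ≤ t → 1 / (1 + 1 * t) ^ (2 : ℝ) = (t + 1) ^ (-2 : ℝ) := fun t ht => by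
    rw [one_mul, add_comm, Real.rpow_neg (by positivity), one_div]
  refine ⟨fun t => 1 / (1 + 1 * t) ^ (2 : ℝ), ⟨fun t ht => ?_, ?_, ?_⟩,
    1, 1, 2, one_pos, one_pos, two_pos, fun t _ => rfl⟩
  · positivity
  · exact (integrableOn_add_rpow_Ioi_of_lt (a := -2) (c := 0) (m := 1) (by norm_num)
      (by norm_num)).congr_fun (fun t ht => (hpow t (le_of_lt ht)).symm) measurableSet_Ioi
  · rw [setIntegral_congr_fun measurableSet_Ioi fun t ht => hpow t (le_of_lt ht),
      integral_Ioi_comp_add (fun t => t ^ (-2 : ℝ)), zero_add,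
      integral_Ioi_rpow_of_lt (by norm_num) one_pos]
    norm_num

theorem IsGame.mem_Icc_of_tendstoUniformly (H : IsGame V g) {ι : Type*} {F : Filter ι} [F.NeBot]
    {ρ : ι → ℝ → ℝ} (hρ : ∀ᶠ i in F, IsDensity (ρ i))
    (h : TendstoUniformly (fun i => value V g (ρ i)) U F) (ω : Ω) : U ω ∈ Icc (0 : ℝ) 1 :=
  isClosed_Icc.mem_of_tendsto (h.tendsto_at ω) (hρ.mono fun _ hi => H.value_mem hi ω)

theorem ScaleLimit.mem_Icc {μ : ℝ → ℝ} (h : ScaleLimit V g μ U) (H : IsGame V g)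
    (hμ : IsDensity μ) (ω : Ω) : U ω ∈ Icc (0 : ℝ) 1 :=
  H.mem_Icc_of_tendstoUniformly (F := 𝓝[>] (0 : ℝ))
    (by filter_upwards [self_mem_nhdsWithin] with l hl using hμ.scale hl) h ω

/-- If the scalings of one self-similar density converge uniformly, then so do the scalings of
every density, with the same limit. -/
theorem IsSelfSimilar.scaleLimit_of_scaleLimit {ν : ℝ → ℝ} (hν : IsSelfSimilar ν)
    (H : IsGame V g) (h : ScaleLimit V g ν U) {μ : ℝ → ℝ} (hμ : IsDensity μ) :
    ScaleLimit V g μ U :=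
  have hU := h.mem_Icc H hν.isDensity
  (hν.isNearlyInvariant H hU h).scaleLimit H hU hμ

theorem _root_.Continuous.isPiecewiseContinuous {f : ℝ → ℝ} (hf : Continuous f) :
    IsPiecewiseContinuous f := by
  refine ⟨fun a b _ => ?_, fun t _ => ⟨⟨f t, ?_⟩, ⟨f t, ?_⟩⟩⟩
  · simp [hf.continuousAt]
  · exact hf.continuousAt.mono_left nhdsWithin_le_nhds
  · exact hf.continuousAt.mono_left nhdsWithin_le_nhds

/-- Each of the three kinds of limits forces the scaling limits of all densities. -/
theorem IsGame.scaleLimit_of_limit (H : IsGame V g)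
    (h : CesaroLimit V g U ∨ AbelLimit V g U ∨ ∃ ρ, IsPowerDensity ρ ∧ ShiftLimit V g ρ U)
    {μ : ℝ → ℝ} (hμ : IsDensity μ) : ScaleLimit V g μ U := by
  rcases h with h | h | ⟨ρ, hρ, h⟩
  · exact isSelfSimilar_uniformDensity.scaleLimit_of_scaleLimit H
      (cesaroLimit_iff_scaleLimit.1 h) hμ
  · exact isSelfSimilar_expDensity.scaleLimit_of_scaleLimit H (abelLimit_iff_scaleLimit.1 h) hμ
  · exact hρ.isSelfSimilar.scaleLimit_of_scaleLimit H (hρ.shiftLimit_iff_scaleLimit.1 h) hμ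

end
end GameMap

theorem mainTheorem1 {Ω : Type*} [Nonempty Ω] (K : Set (ℝ≥0 → Ω)) (hK : K.Nonempty)
    (g : Ω → ℝ) (hg : ∀ ω, g ω ∈ Set.Icc (0 : ℝ) 1)
    (hmeas : ∀ z ∈ K, AEMeasurable (fun t : ℝ => g (z t.toNNReal)) (volume.restrict (Set.Ioi 0)))
    (V : (K → ℝ) → Ω → ℝ) (hV : GameMap.IsGameMap V) (hDPP : GameMap.DynProgPrinciple V g) :
    (∀ U : Ω → ℝ, (∀ ω, U ω ∈ Set.Icc (0 : ℝ) 1) →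
      List.TFAE [
        ∀ μ : ℝ → ℝ, GameMap.IsDensity μ → GameMap.IsPiecewiseContinuous μ →
          GameMap.ScaleLimit V g μ U,
        GameMap.CesaroLimit V g U,
        GameMap.AbelLimit V g U,
        ∃ ρ : ℝ → ℝ, GameMap.IsPowerDensity ρ ∧ GameMap.ShiftLimit V g ρ U,
        ∀ ρ : ℝ → ℝ, GameMap.IsPowerDensity ρ → GameMap.ShiftLimit V g ρ U]) ∧
    (∀ W : Ω → ℝ,
      (GameMap.CesaroLimit V g W ∨ GameMap.AbelLimit V g W ∨
        ∃ ρ : ℝ → ℝ, GameMap.IsPowerDensity ρ ∧ GameMap.ShiftLimit V g ρ W) →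
      GameMap.CesaroLimit V g W ∧ GameMap.AbelLimit V g W ∧
        (∀ ρ : ℝ → ℝ, GameMap.IsPowerDensity ρ → GameMap.ShiftLimit V g ρ W) ∧
        (∀ μ : ℝ → ℝ, GameMap.IsDensity μ → GameMap.IsPiecewiseContinuous μ →
          GameMap.ScaleLimit V g μ W)) := by
  have H : GameMap.IsGame V g := ⟨hg, hmeas, hV, hDPP⟩
  have all : ∀ W : Ω → ℝ,
      (GameMap.CesaroLimit V g W ∨ GameMap.AbelLimit V g W ∨
        ∃ ρ : ℝ → ℝ, GameMap.IsPowerDensity ρ ∧ GameMap.ShiftLimit V g ρ W) →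
      GameMap.CesaroLimit V g W ∧ GameMap.AbelLimit V g W ∧
        (∀ ρ : ℝ → ℝ, GameMap.IsPowerDensity ρ → GameMap.ShiftLimit V g ρ W) ∧
        (∀ μ : ℝ → ℝ, GameMap.IsDensity μ → GameMap.IsPiecewiseContinuous μ →
          GameMap.ScaleLimit V g μ W) := fun W h => by
    have key : ∀ μ, GameMap.IsDensity μ → GameMap.ScaleLimit V g μ W :=
      fun μ hμ => H.scaleLimit_of_limit h hμ
    exact ⟨GameMap.cesaroLimit_iff_scaleLimit.2 (key _ GameMap.isDensity_uniformDensity_one),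
      GameMap.abelLimit_iff_scaleLimit.2 (key _ GameMap.isSelfSimilar_expDensity.isDensity),
      fun ρ hρ => hρ.shiftLimit_iff_scaleLimit.2 (key _ hρ.1), fun μ hμ _ => key μ hμ⟩
  refine ⟨fun U _ => ?_, all⟩
  tfae_have 1 → 3 := fun h => GameMap.abelLimit_iff_scaleLimit.2 <|
    h _ GameMap.isSelfSimilar_expDensity.isDensity
      GameMap.continuous_expDensity.isPiecewiseContinuous
  tfae_have 3 → 2 := fun h => (all U (Or.inr (Or.inl h))).1
  tfae_have 2 → 5 := fun h => (all U (Or.inl h)).2.2.1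
  tfae_have 5 → 4 := fun h =>
    let ⟨ρ, hρ⟩ := GameMap.exists_isPowerDensity
    ⟨ρ, hρ, h ρ hρ⟩
  tfae_have 4 → 1 := fun h => (all U (Or.inr (Or.inr h))).2.2.2
  tfae_finish
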